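/- Let $A$ be a $d\times d$ matrix with entries in $\{0,1\}$, and let $G=\langle s_1,\dots,s_d \mid s_is_j=s_i \text{ whenever } A(i,j)=0\rangle$ be the monoid it presents; assume that in $G$ one has $s_is_j=s_i$ if and only if $A(i,j)=0$. Call $s_i$ right free if $A(i,j)=1$ for all $j$, and let $|g|$ be the least number of generators whose product is $g$. Assume that there is at least one right free generator and that $G$ has a finite representation: there are only finitely many $g\in G$ with a minimal presentation $g=g_1\cdots g_n$ such that none of $g_1,\dots,g_{n-1}$ is right free. Let $\mathcal A$ be a finite alphabet with at least two symbols and $\Delta_n=\{g\in G:|g|\le n\}$. An $n$-block is a function $\tau:\Delta_n\to\mathcal A$; a labeled tree $t:G\to\mathcal A$ accepts $\tau$ if for some $g\in G$ one has $t_{gg'}=\tau_{g'}$ for all $g'\in\Delta_n$, and otherwise avoids it. A $G$-SFT of step $m$ is the set $X\subseteq\mathcal A^G$ of all labeled trees that avoid every block of some finite set of blocks of sizes at most $m$ (so every shift space given by finitely many forbidden blocks is a $G$-SFT of step $m$ for some $m \geq 1$). Let $\gamma_n$ be the number of distinct restrictions $t|_{\Delta_n}$ with $t\in X$, and let $$\deg(X)=\limsup_{n\to\infty}\frac{\ln\ln\gamma_n}{n}.$$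 A symbol $a\in\mathcal A$ is essential if for some $n$ the trees $t\in X$ with $t_e=a$ have at least two distinct restrictions to $\Delta_n$. More generally, an $m$-block $b$ is essential if for some $n$ the trees $t\in X$ with $t|_{\Delta_m}=b$ have at least two distinct restrictions to $\Delta_n$. Let $\rho_A$ be the spectral radius of $A$. (a) If $X$ is a $G$-SFT of step $1$ and every symbol $a\in\mathcal A$ is essential, then $\deg(X)=\ln\rho_A$. (b) More generally, for every $m\ge 0$: if $X$ is a nonempty $G$-SFT of step $m+1$ and every $m$-block $t|_{\Delta_m}$, $t\in X$ (that is, every symbol of the one-step presentation of $X$ by $m$-blocks) is essential, then $\deg(X)=\ln\rho_A$. -/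

import Mathlib

namespace MonoidShift

variable {d : ℕ}

/-- The defining relations `s_i s_j = s_i` for all `i, j` with `A i j = 0`. -/
inductive Rel (A : Matrix (Fin d) (Fin d) ℕ) : FreeMonoid (Fin d) → FreeMonoid (Fin d) → Prop
  | absorb (i j : Fin d) (h : A i j = 0) :
      Rel A (FreeMonoid.of i * FreeMonoid.of j) (FreeMonoid.of i)

/-- The monoid `G = ⟨s_1, …, s_d | R_A⟩`. -/
abbrev G (A : Matrix (Fin d) (Fin d) ℕ) : Type := PresentedMonoid (Rel A)

/-- The generator `s_i` of `G`. -/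
def gen (A : Matrix (Fin d) (Fin d) ℕ) (i : Fin d) : G A := PresentedMonoid.of (Rel A) i

/-- `A` is a binary matrix, and in the monoid presented by `R_A` one has `s_i s_j = s_i`
if and only if `A i j = 0`. -/
def Determines (A : Matrix (Fin d) (Fin d) ℕ) : Prop :=
  (∀ i j, A i j = 0 ∨ A i j = 1) ∧ ∀ i j, gen A i * gen A j = gen A i ↔ A i j = 0

/-- `s_i` is a right free generator. -/
def IsRightFree (A : Matrix (Fin d) (Fin d) ℕ) (i : Fin d) : Prop := ∀ j, A i j = 1

/-- The element of `G` spelled by a word in the generators. -/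
def spell (A : Matrix (Fin d) (Fin d) ℕ) (w : List (Fin d)) : G A := (w.map (gen A)).prod

/-- The length `|g|`: the least number of generators in a presentation of `g`. -/
noncomputable def length (A : Matrix (Fin d) (Fin d) ℕ) (g : G A) : ℕ :=
  sInf {n | ∃ w : List (Fin d), w.length = n ∧ spell A w = g}

/-- The vertex set of the graph `F`: the elements of `G` with a minimal presentation
`g_1 ⋯ g_n` in which no letter before the last one is a right free generator. -/
def vertexF (A : Matrix (Fin d) (Fin d) ℕ) : Set (G A) :=
  {g | ∃ w : List (Fin d), spell A w = g ∧ w.length = length A g ∧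
    ∀ i ∈ w.dropLast, ¬ IsRightFree A i}

/-- `G` has a finite representation. -/
def HasFiniteRepresentation (A : Matrix (Fin d) (Fin d) ℕ) : Prop := (vertexF A).Finite

/-- The ball `Δ_n = {g : |g| ≤ n}`. -/
def Δ (A : Matrix (Fin d) (Fin d) ℕ) (n : ℕ) : Set (G A) := {g | length A g ≤ n}

variable {𝒜 : Type*}

/-- A block together with its size: an `n`-block is a function `Δ_n → 𝒜`. -/
abbrev Block (A : Matrix (Fin d) (Fin d) ℕ) (𝒜 : Type*) : Type _ := Σ n : ℕ, (Δ A n → 𝒜)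

/-- The labeled tree `t` accepts the block `τ` (at some `g ∈ G`). -/
def Accepts (A : Matrix (Fin d) (Fin d) ℕ) (t : G A → 𝒜) (τ : Block A 𝒜) : Prop :=
  ∃ g : G A, ∀ g' : Δ A τ.1, t (g * g') = τ.2 g'

/-- The `G`-shift space of all labeled trees that avoid every block of `F`. -/
def shiftSpace (A : Matrix (Fin d) (Fin d) ℕ) (F : Set (Block A 𝒜)) : Set (G A → 𝒜) :=
  {t | ∀ τ ∈ F, ¬ Accepts A t τ}

/-- `X` is a `G`-SFT of step `m`: a `G`-shift space given by a finite set of forbidden blocks of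
size at most `m`. Every finite set of forbidden blocks has such a bound `m`. -/
def IsSFT (A : Matrix (Fin d) (Fin d) ℕ) (m : ℕ) (X : Set (G A → 𝒜)) : Prop :=
  ∃ F : Set (Block A 𝒜), F.Finite ∧ (∀ τ ∈ F, τ.1 ≤ m) ∧ X = shiftSpace A F

/-- The `n`-block of the labeled tree `t` at the root. -/
def rootBlock (A : Matrix (Fin d) (Fin d) ℕ) (n : ℕ) (t : G A → 𝒜) : Δ A n → 𝒜 := fun g => t g

/-- The set `Γ_n(X)` of `n`-blocks of `X` rooted at the identity. -/
def blocks (A : Matrix (Fin d) (Fin d) ℕ) (X : Set (G A → 𝒜)) (n : ℕ) : Set (Δ A n → 𝒜) :=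
  rootBlock A n '' X

/-- The symbol `a` is essential: for some `n` at least two `n`-blocks of `X` have the label `a`
at the root. -/
def IsEssential (A : Matrix (Fin d) (Fin d) ℕ) (X : Set (G A → 𝒜)) (a : 𝒜) : Prop :=
  ∃ n, 2 ≤ (blocks A {t ∈ X | t 1 = a} n).ncard

/-- The `m`-block `b` is essential: for some `n` at least two `n`-blocks of `X` come from labeled
trees of `X` that extend `b`. -/
def IsEssentialBlock (A : Matrix (Fin d) (Fin d) ℕ) (X : Set (G A → 𝒜)) {m : ℕ}
    (b : Δ A m → 𝒜) : Prop :=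
  ∃ n, 2 ≤ (blocks A {t ∈ X | rootBlock A m t = b} n).ncard

/-- The topological degree `limsup (ln ln γ_n) / n` with `γ_n = |Γ_n(X)|`. -/
noncomputable def deg (A : Matrix (Fin d) (Fin d) ℕ) (X : Set (G A → 𝒜)) : EReal :=
  Filter.limsup
    (fun n : ℕ => ((Real.log (Real.log ((blocks A X n).ncard : ℝ)) / (n : ℝ) : ℝ) : EReal))
    Filter.atTop

/-- The spectral radius `ρ_A` of `A`, as a complex matrix. -/
noncomputable def rho (A : Matrix (Fin d) (Fin d) ℕ) : ℝ :=
  (spectralRadius ℂ (A.map (fun x : ℕ => (x : ℂ)))).toReal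

end MonoidShift

namespace MonoidShift

variable {d : ℕ} {A : Matrix (Fin d) (Fin d) ℕ} {𝒜 : Type*}

/-! ### Normal forms -/

/-! Up to a polynomial factor and a bounded shift of `n`, `ln γ_n` has the size of `Δ_n`, which
grows like `ρ_A ^ n`.

Elements of `G` correspond to reduced words. Those of length `n + 1` number the sum of the entries
of `A ^ n`, whose growth rate is `ρ_A` by Gelfand's formula (`tendsto_log_entrySum_div`). Since `γ_n
≤ |𝒜| ^ |Δ_n|`, this will bound the degree from above.

For the lower bound, let `g` have length `n` and end in a right free letter. Nothing multiplied on
the right is absorbed by `g`, so the sets `gG` are disjoint copies of `G`. In a tree of `X`, the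
subtree at each such `g` can be replaced independently by either of two trees of `X` with the same
`m`-block at the root (`glue_mem_shiftSpace`). If `r_n` is the number of such `g`, then `2 ^ r_n ≤
γ_{n+N}` for a fixed `N`. Finite representation gives `|Δ_n| ≤ C (n + 1) r_n` (`ncard_Δ_le`), and
this loss disappears after `ln ln` and division by `n`. -/

theorem gen_mul_gen {i j : Fin d} (h : A i j = 0) : gen A i * gen A j = gen A i :=
  PresentedMonoid.mk_eq_mk_of_rel (Rel.absorb i j h)

/-- Associativity forces this: `s_i s_k = s_i s_j s_k = s_i s_j = s_i`. It is what makes `pushGen`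
respect the relations. -/
theorem Determines.trans (hA : Determines A) {i j k : Fin d} (hij : A i j = 0)
    (hjk : A j k = 0) : A i k = 0 := by
  rw [← hA.2]
  rw [← hA.2] at hij hjk
  calc gen A i * gen A k = gen A i * gen A j * gen A k := by rw [hij]
    _ = gen A i := by rw [mul_assoc, hjk, hij]

theorem Determines.eq_one (hA : Determines A) {i j : Fin d} (h : A i j ≠ 0) : A i j = 1 :=
  (hA.1 i j).resolve_left h

/-- A word, written from right to left, without factors `s_i s_j` with `A i j = 0`. -/
def IsReduced (A : Matrix (Fin d) (Fin d) ℕ) (v : List (Fin d)) : Prop :=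
  v.IsChain fun j i => A i j = 1

/-- Right multiplication by the generator `s_j` on reduced words written from right to left. -/
def pushGen (A : Matrix (Fin d) (Fin d) ℕ) (j : Fin d) : List (Fin d) → List (Fin d)
  | [] => [j]
  | i :: v => if A i j = 0 then i :: v else j :: i :: v

theorem pushGen_pushGen (hA : Determines A) {i j : Fin d} (h : A i j = 0) (v : List (Fin d)) :
    pushGen A j (pushGen A i v) = pushGen A i v := by
  cases v with
  | nil => simp [pushGen, h]
  | cons k v =>
    by_cases hk : A k i = 0
    · simp [pushGen, hk, hA.trans hk h]
    · simp [pushGen, hk, h]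

theorem IsReduced.pushGen (hA : Determines A) {v : List (Fin d)} (hv : IsReduced A v)
    (j : Fin d) : IsReduced A (pushGen A j v) := by
  cases v with
  | nil => simp [IsReduced, MonoidShift.pushGen]
  | cons i v =>
    by_cases h : A i j = 0
    · simpa [MonoidShift.pushGen, h] using hv
    · simpa [MonoidShift.pushGen, h, IsReduced, hA.eq_one h] using hv

theorem pushGen_of_isReduced_cons {j : Fin d} {v : List (Fin d)} (h : IsReduced A (j :: v)) :
    pushGen A j v = j :: v := by
  cases v with
  | nil => rfl
  | cons i v =>
    have : A i j = 1 := by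
      have := h
      simp only [IsReduced, List.isChain_cons_cons] at this
      exact this.1
    simp [pushGen, this]

theorem suffix_pushGen (j : Fin d) (v : List (Fin d)) : v <:+ pushGen A j v := by
  cases v with
  | nil => simp [pushGen]
  | cons i v =>
    by_cases h : A i j = 0
    · simp [pushGen, h]
    · simp [pushGen, h]

theorem length_pushGen_le (j : Fin d) (v : List (Fin d)) :
    (pushGen A j v).length ≤ v.length + 1 := by
  cases v with
  | nil => simp [pushGen]
  | cons i v =>
    by_cases h : A i j = 0 <;> simp [pushGen, h]

theorem pushGen_append {i : Fin d} (hi : IsRightFree A i) (j : Fin d) (u v : List (Fin d)) :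
    pushGen A j (u ++ i :: v) = pushGen A j u ++ i :: v := by
  cases u with
  | nil => simp [pushGen, hi j]
  | cons k u =>
    by_cases h : A k j = 0 <;> simp [pushGen, h]

/-- The right action of `G` on words written from right to left. -/
def pushHom (hA : Determines A) : G A →* (Function.End (List (Fin d)))ᵐᵒᵖ :=
  -- A right action composes in the order opposite to `Function.End`.
  PresentedMonoid.lift (M := (Function.End (List (Fin d)))ᵐᵒᵖ)
    (fun j => MulOpposite.op (pushGen A j)) (by
    rintro _ _ ⟨i, j, h⟩
    simp only [map_mul, FreeMonoid.lift_eval_of]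
    apply MulOpposite.unop_injective
    funext v
    exact pushGen_pushGen hA h v)

/-- The word `v`, multiplied by `g` on the right. -/
def push (hA : Determines A) (g : G A) (v : List (Fin d)) : List (Fin d) :=
  (pushHom hA g).unop v

theorem push_one (hA : Determines A) (v : List (Fin d)) : push hA 1 v = v := by
  rw [push, map_one]; rfl

theorem push_mul (hA : Determines A) (g h : G A) (v : List (Fin d)) :
    push hA (g * h) v = push hA h (push hA g v) := by
  rw [push, map_mul]; rfl

theorem push_gen (hA : Determines A) (j : Fin d) (v : List (Fin d)) :
    push hA (gen A j) v = pushGen A j v := rfl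

theorem spell_append (u v : List (Fin d)) : spell A (u ++ v) = spell A u * spell A v := by
  simp [spell]

theorem spell_nil : spell A [] = 1 := rfl

theorem spell_concat (u : List (Fin d)) (j : Fin d) :
    spell A (u ++ [j]) = spell A u * gen A j := by
  simp [spell]

theorem spell_surjective : Function.Surjective (spell A) := by
  intro g
  obtain ⟨w, rfl⟩ := PresentedMonoid.surjective_mk g
  induction w with
  | one => exact ⟨[], rfl⟩
  | of x => exact ⟨[x], by simp [spell, gen, PresentedMonoid.of]⟩
  | mul x y hx hy =>
    obtain ⟨u, hu⟩ := hx
    obtain ⟨v, hv⟩ := hy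
    exact ⟨u ++ v, by rw [spell_append, hu, hv, map_mul]⟩

/-- Induction on elements of `G` by right multiplication with generators. -/
theorem gen_induction {p : G A → Prop} (one : p 1) (mul : ∀ g j, p g → p (g * gen A j))
    (g : G A) : p g := by
  obtain ⟨w, rfl⟩ := spell_surjective g
  induction w using List.reverseRecOn with
  | nil => exact one
  | append_singleton w j ih => rw [spell_concat]; exact mul _ _ ih

theorem suffix_push (hA : Determines A) (g : G A) (v : List (Fin d)) : v <:+ push hA g v := by
  induction g using gen_induction with
  | one => rw [push_one]
  | mul g j ih => rw [push_mul, push_gen]; exact ih.trans (suffix_pushGen _ _)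

theorem length_push_spell_le (hA : Determines A) (w v : List (Fin d)) :
    (push hA (spell A w) v).length ≤ v.length + w.length := by
  induction w using List.reverseRecOn with
  | nil => simp [spell_nil, push_one]
  | append_singleton w j ih =>
    rw [spell_concat, push_mul, push_gen]
    have := length_pushGen_le (A := A) j (push hA (spell A w) v)
    simp only [List.length_append, List.length_cons, List.length_nil]
    omega

/-- The normal form of an element of `G`: its reduced word, written from right to left. -/
def normalForm (hA : Determines A) (g : G A) : List (Fin d) := push hA g []

theorem isReduced_normalForm (hA : Determines A) (g : G A) : IsReduced A (normalForm hA g) := by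
  induction g using gen_induction with
  | one => simp [normalForm, push_one, IsReduced]
  | mul g j ih =>
    rw [normalForm, push_mul, push_gen]
    exact IsReduced.pushGen hA ih j

theorem spell_reverse_pushGen (j : Fin d) (v : List (Fin d)) :
    spell A (pushGen A j v).reverse = spell A v.reverse * gen A j := by
  cases v with
  | nil => simp [pushGen, spell]
  | cons i v =>
    by_cases h : A i j = 0
    · simp only [pushGen, h, if_true, List.reverse_cons, spell_concat, mul_assoc, gen_mul_gen h]
    · simp only [pushGen, h, if_false, List.reverse_cons, spell_concat]

theorem spell_reverse_normalForm (hA : Determines A) (g : G A) :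
    spell A (normalForm hA g).reverse = g := by
  induction g using gen_induction with
  | one => simp [normalForm, push_one, spell]
  | mul g j ih =>
    rw [normalForm, push_mul, push_gen, spell_reverse_pushGen]
    rw [normalForm] at ih
    rw [ih]

theorem normalForm_injective (hA : Determines A) : Function.Injective (normalForm hA) :=
  Function.LeftInverse.injective (g := fun v : List (Fin d) => spell A v.reverse)
    (spell_reverse_normalForm hA)

/-- With `spell_reverse_normalForm`, this makes elements of `G` and reduced words the same thing, so
that balls can be counted by words. -/
theorem normalForm_spell_reverse (hA : Determines A) {v : List (Fin d)} (hv : IsReduced A v) :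
    normalForm hA (spell A v.reverse) = v := by
  induction v with
  | nil => exact push_one hA []
  | cons j v ih =>
    have ih := ih (List.IsChain.tail hv)
    rw [normalForm] at ih
    rw [List.reverse_cons, spell_concat, normalForm, push_mul, push_gen, ih,
      pushGen_of_isReduced_cons hv]

theorem exists_spell_length (g : G A) : ∃ w, w.length = length A g ∧ spell A w = g := by
  obtain ⟨w, hw⟩ := spell_surjective g
  exact Nat.sInf_mem (s := {n | ∃ w : List (Fin d), w.length = n ∧ spell A w = g})
    ⟨w.length, w, rfl, hw⟩

theorem length_push_le (hA : Determines A) (g : G A) (v : List (Fin d)) :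
    (push hA g v).length ≤ v.length + length A g := by
  obtain ⟨w, hw, rfl⟩ := exists_spell_length g
  rw [← hw]
  exact length_push_spell_le hA w v

/-- Each generator lengthens the word by at most one letter, so no spelling is shorter than the
normal form. -/
theorem length_normalForm (hA : Determines A) (g : G A) :
    (normalForm hA g).length = length A g := by
  apply le_antisymm
  · simpa [normalForm] using length_push_le hA g []
  · exact Nat.sInf_le ⟨_, by simp, spell_reverse_normalForm hA g⟩

theorem normalForm_mul (hA : Determines A) (g h : G A) :
    normalForm hA (g * h) = push hA h (normalForm hA g) := push_mul hA g h []

theorem length_mul_le (hA : Determines A) (g h : G A) :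
    length A (g * h) ≤ length A g + length A h := by
  rw [← length_normalForm hA, normalForm_mul, ← length_normalForm hA g]
  exact length_push_le hA h _

/-- The last letter of `g` is a right free generator. -/
def EndsRightFree (hA : Determines A) (g : G A) : Prop :=
  ∃ i v, IsRightFree A i ∧ normalForm hA g = i :: v

/-- A right free letter absorbs nothing, so multiplication after it is plain concatenation. -/
theorem EndsRightFree.normalForm_mul {hA : Determines A} {g : G A} (hg : EndsRightFree hA g)
    (h : G A) : normalForm hA (g * h) = normalForm hA h ++ normalForm hA g := by
  obtain ⟨i, v, hi, hgv⟩ := hg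
  rw [MonoidShift.normalForm_mul, hgv]
  induction h using gen_induction with
  | one => simp [normalForm, push_one]
  | mul h j ih =>
    rw [push_mul, ih, push_gen, pushGen_append hi, MonoidShift.normalForm_mul, push_gen]

theorem EndsRightFree.mul_inj {hA : Determines A} {g g' h h' : G A} (hg : EndsRightFree hA g)
    (hg' : EndsRightFree hA g') (hl : length A g = length A g') (he : g * h = g' * h') :
    g = g' ∧ h = h' := by
  have := congrArg (normalForm hA) he
  rw [hg.normalForm_mul, hg'.normalForm_mul] at this
  obtain ⟨h1, h2⟩ := List.append_inj' this (by simpa [length_normalForm] using hl)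
  exact ⟨normalForm_injective hA h2, normalForm_injective hA h1⟩

theorem exists_mul_of_suffix (hA : Determines A) {g h : G A}
    (hs : normalForm hA g <:+ normalForm hA h) : ∃ x, h = g * x := by
  obtain ⟨u, hu⟩ := hs
  refine ⟨spell A u.reverse, ?_⟩
  rw [← spell_reverse_normalForm hA h, ← hu, List.reverse_append, spell_append,
    spell_reverse_normalForm]

/-! ### Counting reduced words -/

/-- The words `v` of length `n` such that `j :: v` is reduced. -/
def tails (A : Matrix (Fin d) (Fin d) ℕ) : ℕ → Fin d → Finset (List (Fin d))
  | 0, _ => {[]}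
  | n + 1, j => (Finset.univ.filter fun i => A i j = 1).biUnion fun i =>
      (tails A n i).image (List.cons i)

theorem mem_tails {n : ℕ} {j : Fin d} {v : List (Fin d)} :
    v ∈ tails A n j ↔ v.length = n ∧ IsReduced A (j :: v) := by
  induction n generalizing j v with
  | zero =>
    simp only [tails, Finset.mem_singleton, List.length_eq_zero_iff]
    constructor
    · rintro rfl; simp [IsReduced]
    · exact And.left
  | succ n ih =>
    cases v with
    | nil => simp [tails]
    | cons i v => simp [tails, ih, IsReduced]; tauto

theorem card_biUnion_image_cons (s : Finset (Fin d)) (f : Fin d → Finset (List (Fin d))) :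
    (s.biUnion fun i => (f i).image (List.cons i)).card = ∑ i ∈ s, (f i).card := by
  rw [Finset.card_biUnion]
  · exact Finset.sum_congr rfl fun i _ =>
      Finset.card_image_of_injective _ (List.cons_injective)
  · intro i _ j _ hij
    refine Finset.disjoint_left.2 ?_
    intro v hi hj
    simp only [Finset.mem_image] at hi hj
    obtain ⟨_, _, rfl⟩ := hi
    obtain ⟨_, _, h⟩ := hj
    exact hij (List.cons.inj h).1.symm

/-- A column sum appears because words are extended to the left of `s_j` in the order of
multiplication. -/
theorem card_tails (hA : Determines A) (n : ℕ) (j : Fin d) :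
    (tails A n j).card = ∑ i, (A ^ n) i j := by
  induction n generalizing j with
  | zero => simp [tails, Matrix.one_apply]
  | succ n ih =>
    rw [tails, card_biUnion_image_cons, Finset.sum_filter]
    simp_rw [pow_succ, Matrix.mul_apply]
    rw [Finset.sum_comm]
    refine Finset.sum_congr rfl fun i _ => ?_
    rw [← Finset.sum_mul, ← ih]
    rcases hA.1 i j with h | h <;> simp [h]

/-- The reduced words of length `n + 1`. -/
def words (A : Matrix (Fin d) (Fin d) ℕ) (n : ℕ) : Finset (List (Fin d)) :=
  Finset.univ.biUnion fun i => (tails A n i).image (List.cons i)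

theorem mem_words {n : ℕ} {v : List (Fin d)} :
    v ∈ words A n ↔ v.length = n + 1 ∧ IsReduced A v := by
  cases v with
  | nil => simp [words]
  | cons i v => simp [words, mem_tails]

/-- The sum of the entries of `A ^ n`. -/
def entrySum (A : Matrix (Fin d) (Fin d) ℕ) (n : ℕ) : ℕ := ∑ i, ∑ j, (A ^ n) i j

theorem card_words (hA : Determines A) (n : ℕ) : (words A n).card = entrySum A n := by
  rw [words, card_biUnion_image_cons, Finset.sum_congr rfl fun j _ => card_tails hA n j]
  exact Finset.sum_comm

theorem finite_Δ (hA : Determines A) (n : ℕ) : (Δ A n).Finite := by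
  refine Set.Finite.of_injOn (f := normalForm hA) (t := {v | v.length ≤ n}) ?_
    (normalForm_injective hA).injOn (List.finite_length_le _ n)
  intro g hg
  exact (length_normalForm hA g).trans_le hg

/-- The elements of length `n` whose last letter is right free. -/
def rightFreeSphere (hA : Determines A) (n : ℕ) : Set (G A) :=
  {g | length A g = n ∧ EndsRightFree hA g}

theorem rightFreeSphere_finite (hA : Determines A) (n : ℕ) : (rightFreeSphere hA n).Finite :=
  (finite_Δ hA n).subset fun _ hg => hg.1.le

theorem ncard_rightFreeSphere_le (hA : Determines A) (n : ℕ) :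
    (rightFreeSphere hA (n + 1)).ncard ≤ entrySum A n := by
  rw [← card_words hA, ← Set.ncard_coe_finset]
  refine Set.ncard_le_ncard_of_injOn (normalForm hA) ?_ (normalForm_injective hA).injOn
    (Finset.finite_toSet _)
  intro g hg
  rw [Finset.mem_coe, mem_words]
  exact ⟨by rw [length_normalForm, hg.1], isReduced_normalForm hA g⟩

theorem entrySum_le_ncard_Δ (hA : Determines A) (n : ℕ) :
    entrySum A n ≤ (Δ A (n + 1)).ncard := by
  rw [← card_words hA, ← Set.ncard_coe_finset]
  refine Set.ncard_le_ncard_of_injOn (fun v => spell A v.reverse) ?_ ?_ (finite_Δ hA _)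
  · intro v hv
    rw [Finset.mem_coe, mem_words] at hv
    change length A _ ≤ n + 1
    rw [← length_normalForm hA, normalForm_spell_reverse hA hv.2, hv.1]
  · intro u hu v hv h
    rw [Finset.mem_coe, mem_words] at hu hv
    rw [← normalForm_spell_reverse hA hu.2, ← normalForm_spell_reverse hA hv.2]
    exact congrArg _ h

/-- Right freeness includes `A i i = 1`, so the letter can be repeated to pad a word to any larger
length. -/
theorem isReduced_replicate_append {i : Fin d} (hi : IsRightFree A i) {v : List (Fin d)}
    (hv : IsReduced A (i :: v)) (n : ℕ) : IsReduced A (List.replicate n i ++ i :: v) := by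
  induction n with
  | zero => simpa using hv
  | succ n ih =>
    rw [List.replicate_succ, List.cons_append]
    cases n with
    | zero => simpa [IsReduced, hi i] using hv
    | succ n =>
      rw [List.replicate_succ, List.cons_append] at ih ⊢
      exact List.IsChain.cons_cons (hi i) ih

theorem replicate_append_mem_rightFreeSphere (hA : Determines A) {i : Fin d}
    (hi : IsRightFree A i) {v : List (Fin d)} (hv : IsReduced A (i :: v)) (n : ℕ) :
    spell A (List.replicate n i ++ i :: v).reverse ∈ rightFreeSphere hA (n + (v.length + 1)) := by
  have hnf := normalForm_spell_reverse hA (isReduced_replicate_append hi hv n)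
  refine ⟨by rw [← length_normalForm hA, hnf]; simp, ?_⟩
  rw [EndsRightFree, hnf]
  cases n with
  | zero => exact ⟨i, v, hi, rfl⟩
  | succ n => exact ⟨i, _, hi, by rw [List.replicate_succ, List.cons_append]⟩

theorem exists_first_of_forall_not_or {α : Type*} (p : α → Prop) (v : List α) :
    (∀ i ∈ v, ¬ p i) ∨ ∃ u i w, v = u ++ i :: w ∧ (∀ j ∈ u, ¬ p j) ∧ p i := by
  induction v with
  | nil => simp
  | cons k v ih =>
    by_cases hk : p k
    · exact Or.inr ⟨[], k, v, rfl, by simp, hk⟩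
    · rcases ih with h | ⟨u, i, w, rfl, hu, hi⟩
      · left; simpa [hk] using h
      · exact Or.inr ⟨k :: u, i, w, rfl, by simpa [hk] using hu, hi⟩

theorem spell_reverse_mem_vertexF (hA : Determines A) {v : List (Fin d)} (hv : IsReduced A v)
    (h : ∀ i ∈ v, ¬ IsRightFree A i) : spell A v.reverse ∈ vertexF A := by
  refine ⟨v.reverse, rfl, ?_, fun i hi => h i ?_⟩
  · rw [← length_normalForm hA, normalForm_spell_reverse hA hv, List.length_reverse]
  · exact List.mem_reverse.1 (List.mem_of_mem_dropLast hi)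

/-- Every element of the ball is obtained from an element that ends with a right free letter by
deleting some of the last letters, and then appending a word without right free letters. -/
theorem exists_normalForm_eq (hA : Determines A) (hfree : ∃ i, IsRightFree A i) {n : ℕ}
    (hn : 1 ≤ n) {g : G A} (hg : g ∈ Δ A n) :
    ∃ x ∈ vertexF A, ∃ k ∈ Set.Iic n, ∃ y ∈ rightFreeSphere hA n,
      normalForm hA x ++ (normalForm hA y).drop k = normalForm hA g := by
  have hred := isReduced_normalForm hA g
  have hlen : (normalForm hA g).length ≤ n := by rw [length_normalForm]; exact hg
  rcases exists_first_of_forall_not_or (IsRightFree A) (normalForm hA g) with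
    h | ⟨u, i, w, he, hu, hi⟩
  -- Without right free letters, `y = s_i ^ n` serves as a dummy: all its `n` letters are dropped.
  · obtain ⟨i, hi⟩ := hfree
    have hii : IsReduced A [i] := by simp [IsReduced]
    refine ⟨_, spell_reverse_mem_vertexF hA hred h, n, Set.mem_Iic.2 le_rfl,
      spell A (List.replicate (n - 1) i ++ [i]).reverse, ?_, ?_⟩
    · have := replicate_append_mem_rightFreeSphere hA hi hii (n - 1)
      simpa [Nat.sub_add_cancel hn] using this
    · rw [normalForm_spell_reverse hA hred,
        normalForm_spell_reverse hA (isReduced_replicate_append hi hii _),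
        List.drop_of_length_le, List.append_nil]
      simp; omega
  · rw [he] at hred hlen ⊢
    have hredu : IsReduced A u := List.IsChain.left_of_append hred
    have hredw : IsReduced A (i :: w) := List.IsChain.right_of_append hred
    simp only [List.length_append, List.length_cons] at hlen
    -- Here `i` is the last right free letter of `g`; `y` repeats it up to length `n`, and `k`
    -- counts the added copies.
    refine ⟨_, spell_reverse_mem_vertexF hA hredu hu, n - (w.length + 1),
      Set.mem_Iic.2 (Nat.sub_le _ _),
      spell A (List.replicate (n - (w.length + 1)) i ++ i :: w).reverse, ?_, ?_⟩
    · have := replicate_append_mem_rightFreeSphere hA hi hredw (n - (w.length + 1))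
      rwa [Nat.sub_add_cancel (by omega)] at this
    · rw [normalForm_spell_reverse hA hredu,
        normalForm_spell_reverse hA (isReduced_replicate_append hi hredw _),
        List.drop_left' (by simp)]

theorem ncard_Δ_le (hA : Determines A) (hfin : HasFiniteRepresentation A)
    (hfree : ∃ i, IsRightFree A i) {n : ℕ} (hn : 1 ≤ n) :
    (Δ A n).ncard ≤ (vertexF A).ncard * ((n + 1) * (rightFreeSphere hA n).ncard) := by
  have hfs : (vertexF A ×ˢ (Set.Iic n ×ˢ rightFreeSphere hA n)).Finite :=
    hfin.prod ((Set.finite_Iic n).prod (rightFreeSphere_finite hA n))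
  have hsub : normalForm hA '' Δ A n ⊆ (fun z : G A × ℕ × G A =>
      normalForm hA z.1 ++ (normalForm hA z.2.2).drop z.2.1) ''
        (vertexF A ×ˢ (Set.Iic n ×ˢ rightFreeSphere hA n)) := by
    rintro _ ⟨g, hg, rfl⟩
    obtain ⟨x, hx, k, hk, y, hy, h⟩ := exists_normalForm_eq hA hfree hn hg
    exact ⟨(x, k, y), ⟨hx, hk, hy⟩, h⟩
  calc (Δ A n).ncard = (normalForm hA '' Δ A n).ncard :=
        (Set.ncard_image_of_injective _ (normalForm_injective hA)).symm
    _ ≤ _ := Set.ncard_le_ncard hsub (hfs.image _)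
    _ ≤ _ := Set.ncard_image_le hfs
    _ = _ := by
      rw [Set.ncard_prod, Set.ncard_prod, ← Nat.card_coe_set_eq (Set.Iic n)]
      simp

/-! ### Replacing subtrees -/

open Classical in
/-- The tree `t` with the subtree at each `g ∈ S` replaced by `u g`. -/
noncomputable def glue (S : Set (G A)) (t : G A → 𝒜) (u : G A → G A → 𝒜) (h : G A) : 𝒜 :=
  if H : ∃ z : G A × G A, z.1 ∈ S ∧ h = z.1 * z.2 then u H.choose.1 H.choose.2 else t h

/-- By `EndsRightFree.mul_inj` the factorization chosen in `glue` is unique. -/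
theorem glue_mul {hA : Determines A} {n : ℕ} (t : G A → 𝒜) (u : G A → G A → 𝒜) {g : G A}
    (hg : g ∈ rightFreeSphere hA n) (h : G A) :
    glue (rightFreeSphere hA n) t u (g * h) = u g h := by
  have H : ∃ z : G A × G A, z.1 ∈ rightFreeSphere hA n ∧ g * h = z.1 * z.2 := ⟨(g, h), hg, rfl⟩
  obtain ⟨h1, h2⟩ := H.choose_spec
  obtain ⟨h3, h4⟩ := hg.2.mul_inj h1.2 (hg.1.trans h1.1.symm) h2
  rw [glue, dif_pos H, ← h3, ← h4]

theorem glue_of_not_exists {S : Set (G A)} (t : G A → 𝒜) (u : G A → G A → 𝒜) {h : G A}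
    (H : ¬ ∃ z : G A × G A, z.1 ∈ S ∧ h = z.1 * z.2) : glue S t u h = t h := by
  rw [glue, dif_neg H]

/-- A forbidden block rooted inside a replaced subtree would occur in some `u g`. One rooted outside
reaches at most depth `m` into such a subtree, where `u g` agrees with `t`, so it would occur in
`t`. -/
theorem glue_mem_shiftSpace {hA : Determines A} {n m : ℕ} {F : Set (Block A 𝒜)}
    (hF : ∀ τ ∈ F, τ.1 ≤ m + 1) {t : G A → 𝒜} (ht : t ∈ shiftSpace A F) {u : G A → G A → 𝒜}
    (hu : ∀ g, u g ∈ shiftSpace A F) (hut : ∀ g, ∀ h ∈ Δ A m, u g h = t (g * h)) :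
    glue (rightFreeSphere hA n) t u ∈ shiftSpace A F := by
  rintro τ hτ ⟨h, hh⟩
  by_cases H : ∃ z : G A × G A, z.1 ∈ rightFreeSphere hA n ∧ h = z.1 * z.2
  · obtain ⟨⟨g, x⟩, hg, rfl⟩ := H
    refine hu g τ hτ ⟨x, fun g' => ?_⟩
    rw [← hh, mul_assoc, glue_mul t u hg]
  · refine ht τ hτ ⟨h, fun g' => ?_⟩
    rw [← hh]
    by_cases H' : ∃ z : G A × G A, z.1 ∈ rightFreeSphere hA n ∧ h * g' = z.1 * z.2
    · obtain ⟨⟨g, x⟩, hg, he⟩ := H'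
      dsimp only at he hg
      rw [he, glue_mul t u hg, hut]
      have h1 : normalForm hA g <:+ normalForm hA (h * g') := by
        rw [he, hg.2.normalForm_mul]
        exact List.suffix_append _ _
      have h2 : normalForm hA h <:+ normalForm hA (h * g') := by
        rw [normalForm_mul]
        exact suffix_push hA _ _
      have h3 : ¬ normalForm hA g <:+ normalForm hA h := fun hs => by
        obtain ⟨y, hy⟩ := exists_mul_of_suffix hA hs
        exact H ⟨(g, y), hg, hy⟩
      -- Thus `h` is a proper prefix of `g`; being strictly shorter, it costs the block of size `m +
      -- 1` at least one level.
      have h4 : normalForm hA h <:+ normalForm hA g :=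
        (List.suffix_or_suffix_of_suffix h2 h1).resolve_right h3
      have h5 : length A h < length A g := by
        rw [← length_normalForm hA, ← length_normalForm hA]
        refine lt_of_le_of_ne h4.length_le fun hl => h3 ?_
        rw [h4.eq_of_length hl]
      have h6 : length A (h * g') = length A x + length A g := by
        rw [he, ← length_normalForm hA, hg.2.normalForm_mul, List.length_append,
          length_normalForm, length_normalForm]
      have h7 := length_mul_le hA h g'
      have h8 : length A (g' : G A) ≤ m + 1 := le_trans g'.2 (hF τ hτ)
      change length A x ≤ m
      omega
    · rw [glue_of_not_exists t u H']

theorem shift_mem_shiftSpace {F : Set (Block A 𝒜)} {t : G A → 𝒜} (ht : t ∈ shiftSpace A F)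
    (g : G A) : (fun h => t (g * h)) ∈ shiftSpace A F := by
  rintro τ hτ ⟨h, hh⟩
  exact ht τ hτ ⟨g * h, fun g' => by rw [mul_assoc]; exact hh g'⟩

theorem finite_block (hA : Determines A) [Finite 𝒜] (n : ℕ) : Finite (Δ A n → 𝒜) := by
  have := (finite_Δ hA n).to_subtype
  infer_instance

theorem exists_forall_essential_pair (hA : Determines A) [Finite 𝒜] {X : Set (G A → 𝒜)} {m : ℕ}
    (hX : ∀ b ∈ blocks A X m, IsEssentialBlock A X b) :
    ∃ N, ∀ b ∈ blocks A X m, ∃ u ∈ X, ∃ v ∈ X, rootBlock A m u = b ∧ rootBlock A m v = b ∧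
      ∃ h ∈ Δ A N, u h ≠ v h := by
  have := finite_block (𝒜 := 𝒜) hA m
  choose! n hn using hX
  -- There are finitely many `m`-blocks, so one depth `N` serves for all of them.
  obtain ⟨N, hN⟩ := ((blocks A X m).toFinite.image n).bddAbove
  refine ⟨N, fun b hb => ?_⟩
  obtain ⟨_, ⟨u, ⟨hu, hub⟩, rfl⟩, _, ⟨v, ⟨hv, hvb⟩, rfl⟩, huv⟩ :=
    (Set.one_lt_ncard_iff_nontrivial_and_finite.1 (hn b hb)).1
  obtain ⟨h, hh⟩ := Function.ne_iff.1 huv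
  exact ⟨u, hu, v, hv, hub, hvb, h, le_trans h.2 (hN ⟨b, hb, rfl⟩), hh⟩

theorem exists_two_pow_le_ncard_blocks (hA : Determines A) [Finite 𝒜] {X : Set (G A → 𝒜)} {m : ℕ}
    (hSFT : IsSFT A (m + 1) X) (hne : X.Nonempty)
    (hX : ∀ b ∈ blocks A X m, IsEssentialBlock A X b) :
    ∃ N, ∀ n, 2 ^ (rightFreeSphere hA n).ncard ≤ (blocks A X (n + N)).ncard := by
  obtain ⟨N, hN⟩ := exists_forall_essential_pair hA hX
  refine ⟨N, fun n => ?_⟩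
  obtain ⟨F, -, hF, rfl⟩ := hSFT
  obtain ⟨t, ht⟩ := hne
  have key : ∀ g : G A, ∃ U : Bool → G A → 𝒜, (∀ b, U b ∈ shiftSpace A F) ∧
      (∀ b, ∀ h ∈ Δ A m, U b h = t (g * h)) ∧ ∃ h ∈ Δ A N, ∀ b c, b ≠ c → U b h ≠ U c h := by
    intro g
    obtain ⟨u, hu, v, hv, hub, hvb, h, hh, huv⟩ :=
      hN _ ⟨_, shift_mem_shiftSpace ht g, rfl⟩
    refine ⟨fun b => if b then u else v, ?_, ?_, h, hh, ?_⟩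
    · intro b; cases b <;> simpa
    · intro b h hh
      cases b
      · exact congrFun hvb ⟨h, hh⟩
      · exact congrFun hub ⟨h, hh⟩
    · intro b c hbc
      cases b <;> cases c <;> simp_all [huv.symm]
  choose U hUX hUt p hp hUp using key
  have := (rightFreeSphere_finite hA n).to_subtype
  have := finite_block (𝒜 := 𝒜) hA (n + N)
  classical
  -- The value `false` off the sphere is never read by `glue`.
  let ext : (rightFreeSphere hA n → Bool) → G A → Bool := fun σ g =>
    if H : g ∈ rightFreeSphere hA n then σ ⟨g, H⟩ else false
  let f : (rightFreeSphere hA n → Bool) → blocks A (shiftSpace A F) (n + N) := fun σ =>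
    ⟨_, _, glue_mem_shiftSpace (hA := hA) (n := n) hF ht (u := fun g => U g (ext σ g))
      (fun g => hUX g _) (fun g => hUt g _), rfl⟩
  have hf : Function.Injective f := by
    intro σ σ' h
    funext g
    by_contra hne
    have hmem : (g : G A) * p g ∈ Δ A (n + N) := by
      refine (length_mul_le hA _ _).trans ?_
      have h1 : length A (g : G A) = n := g.2.1
      have h2 : length A (p g) ≤ N := hp g
      omega
    have h1 := congrFun (congrArg Subtype.val h) ⟨_, hmem⟩
    simp only [f, rootBlock, glue_mul _ _ g.2] at h1
    refine hUp g _ _ ?_ h1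
    simpa [ext] using hne
  have := Nat.card_le_card_of_injective f hf
  rw [Nat.card_fun] at this
  simpa using this

theorem ncard_blocks_le (hA : Determines A) [Finite 𝒜] (X : Set (G A → 𝒜)) (n : ℕ) :
    (blocks A X n).ncard ≤ Nat.card 𝒜 ^ (Δ A n).ncard := by
  have := (finite_Δ hA n).to_subtype
  have := finite_block (𝒜 := 𝒜) hA n
  calc (blocks A X n).ncard ≤ Nat.card (Δ A n → 𝒜) := by
        rw [← Nat.card_coe_set_eq]
        exact Finite.card_subtype_le _
    _ = _ := by rw [Nat.card_fun, Nat.card_coe_set_eq]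

/-- The ball `Δ A 0` is `{1}`, so a `0`-block is a symbol and part (a) is the case `m = 0`. -/
theorem isEssentialBlock_of_isEssential {X : Set (G A → 𝒜)}
    (hX : ∀ a, IsEssential A X a) (b : Δ A 0 → 𝒜) : IsEssentialBlock A X b := by
  have h1 : (1 : G A) ∈ Δ A 0 := Nat.sInf_le ⟨[], rfl, rfl⟩
  have huniq : ∀ g ∈ Δ A 0, g = 1 := by
    intro g hg
    obtain ⟨w, hw, rfl⟩ := exists_spell_length g
    have : w = [] := List.length_eq_zero_iff.1 (hw.trans (Nat.le_zero.1 hg))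
    rw [this, spell_nil]
  obtain ⟨n, hn⟩ := hX (b ⟨1, h1⟩)
  refine ⟨n, ?_⟩
  convert hn using 6 with t
  constructor
  · rintro rfl; rfl
  · intro h
    funext ⟨g, hg⟩
    obtain rfl := huniq g hg
    exact h

/-! ### Growth rates -/

open Filter Topology

theorem one_le_pow_apply_self {i : Fin d} (hi : A i i = 1) (n : ℕ) : 1 ≤ (A ^ n) i i := by
  induction n with
  | zero => simp
  | succ n ih =>
    rw [pow_succ, Matrix.mul_apply]
    refine le_trans ?_ (Finset.single_le_sum (fun _ _ => Nat.zero_le _) (Finset.mem_univ i))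
    rwa [hi, mul_one]

theorem one_le_entrySum {i : Fin d} (hi : A i i = 1) (n : ℕ) : 1 ≤ entrySum A n :=
  (one_le_pow_apply_self hi n).trans <|
    (Finset.single_le_sum (f := fun j => (A ^ n) i j) (fun _ _ => Nat.zero_le _)
      (Finset.mem_univ i)).trans <|
    Finset.single_le_sum (f := fun i => ∑ j, (A ^ n) i j) (fun _ _ => Nat.zero_le _)
      (Finset.mem_univ i)

theorem tendsto_log_add_two_div_add (s : ℕ) :
    Tendsto (fun n : ℕ => Real.log ((n : ℝ) + 2) / ((n : ℝ) + s)) atTop (𝓝 0) := by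
  have h1 : Tendsto (fun x : ℝ => Real.log x / x) atTop (𝓝 0) := by
    simpa using Real.isLittleO_log_id_atTop.tendsto_div_nhds_zero
  have h2 : Tendsto (fun n : ℕ => (n : ℝ) + 2) atTop atTop :=
    tendsto_atTop_add_const_right _ _ tendsto_natCast_atTop_atTop
  have h3 : Tendsto (fun n : ℕ => ((n : ℝ) + 2) / ((n : ℝ) + s)) atTop (𝓝 1) := by
    have := tendsto_add_mul_div_add_mul_atTop_nhds (2 : ℝ) s 1 one_ne_zero
    simpa [add_comm] using this
  have := (h1.comp h2).mul h3
  rw [zero_mul] at this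
  refine this.congr fun n => ?_
  simp only [Function.comp]
  field_simp

/-- Passing to a shifted denominator and adding logarithmic terms does not change the rate. -/
theorem tendsto_add_log_div_add {x : ℕ → ℝ} {L : ℝ}
    (hx : Tendsto (fun n : ℕ => x n / n) atTop (𝓝 L)) (c c' : ℝ) (s : ℕ) :
    Tendsto (fun n : ℕ => (x n + c * Real.log ((n : ℝ) + 2) + c') / ((n + s : ℕ) : ℝ))
      atTop (𝓝 L) := by
  have h1 : Tendsto (fun n : ℕ => (n : ℝ) / ((n : ℝ) + s)) atTop (𝓝 1) :=
    tendsto_natCast_div_add_atTop (s : ℝ)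
  have h2 : Tendsto (fun n : ℕ => c' / ((n : ℝ) + s)) atTop (𝓝 0) :=
    tendsto_const_nhds.div_atTop
      (tendsto_atTop_add_const_right _ _ tendsto_natCast_atTop_atTop)
  have := ((hx.mul h1).add ((tendsto_log_add_two_div_add s).const_mul c)).add h2
  simp only [mul_one, mul_zero, add_zero] at this
  refine this.congr' ?_
  filter_upwards [eventually_gt_atTop 0] with n hn
  have : (0 : ℝ) < n := by exact_mod_cast hn
  push_cast
  field_simp

/-- The `ℓ^∞` operator norm is the largest row sum, so the entry sum lies between `‖M ^ n‖` and `d *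
‖M ^ n‖`, and Gelfand's formula applies. The loop at a right free generator keeps the norms at least
`1`, hence `ρ_A ≥ 1` and the logarithm is continuous there. -/
theorem tendsto_log_entrySum_div (hfree : ∃ i, IsRightFree A i) :
    Tendsto (fun n : ℕ => Real.log (entrySum A n) / n) atTop (𝓝 (Real.log (rho A))) := by
  let _ : NormedRing (Matrix (Fin d) (Fin d) ℂ) := Matrix.linftyOpNormedRing
  let _ : NormedAlgebra ℂ (Matrix (Fin d) (Fin d) ℂ) := Matrix.linftyOpNormedAlgebra
  have : CompleteSpace (Matrix (Fin d) (Fin d) ℂ) := FiniteDimensional.complete ℂ _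
  obtain ⟨i₀, hi₀⟩ := hfree
  have hdiag := hi₀ i₀
  have : Nonempty (Fin d) := ⟨i₀⟩
  set M : Matrix (Fin d) (Fin d) ℂ := A.map (fun x : ℕ => (x : ℂ)) with hM
  have hpow : ∀ n, M ^ n = (A ^ n).map (fun x : ℕ => (x : ℂ)) := fun n =>
    (map_pow (Nat.castRingHom ℂ).mapMatrix A n).symm
  have hrow : ∀ n i, ((∑ j, ‖(M ^ n) i j‖₊ : NNReal) : ℝ) = ((∑ j, (A ^ n) i j : ℕ) : ℝ) := by
    intro n i
    rw [hpow]
    simp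
  have hle : ∀ n, ‖M ^ n‖ ≤ entrySum A n := by
    intro n
    rw [Matrix.linfty_opNorm_def]
    obtain ⟨i, -, hi⟩ := Finset.exists_mem_eq_sup Finset.univ Finset.univ_nonempty
      (fun i => ∑ j, ‖(M ^ n) i j‖₊)
    rw [hi, hrow]
    exact_mod_cast Finset.single_le_sum (f := fun i => ∑ j, (A ^ n) i j)
      (fun _ _ => Nat.zero_le _) (Finset.mem_univ i)
  have hrow_le : ∀ n i, ((∑ j, (A ^ n) i j : ℕ) : ℝ) ≤ ‖M ^ n‖ := by
    intro n i
    rw [← hrow, Matrix.linfty_opNorm_def]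
    exact_mod_cast Finset.le_sup (f := fun i => ∑ j, ‖(M ^ n) i j‖₊) (Finset.mem_univ i)
  have hge : ∀ n, (entrySum A n : ℝ) ≤ d * ‖M ^ n‖ := by
    intro n
    rw [entrySum, Nat.cast_sum]
    refine (Finset.sum_le_card_nsmul _ _ _ fun i _ => hrow_le n i).trans_eq ?_
    simp
  have hone : ∀ n, 1 ≤ ‖M ^ n‖ := fun n => by
    refine le_trans ?_ (hrow_le n i₀)
    exact_mod_cast (one_le_pow_apply_self hdiag n).trans
      (Finset.single_le_sum (f := fun j => (A ^ n) i₀ j) (fun _ _ => Nat.zero_le _)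
        (Finset.mem_univ i₀))
  have hfinite : spectralRadius ℂ M ≠ ⊤ :=
    ((spectrum.spectralRadius_le_nnnorm M).trans_lt ENNReal.coe_lt_top).ne
  have hroot : Tendsto (fun n : ℕ => ‖M ^ n‖ ^ (1 / n : ℝ)) atTop (𝓝 (rho A)) := by
    have := (ENNReal.tendsto_toReal hfinite).comp
      (spectrum.pow_norm_pow_one_div_tendsto_nhds_spectralRadius M)
    refine this.congr fun n => ?_
    exact ENNReal.toReal_ofReal (by positivity)
  have hrho : 1 ≤ rho A :=
    ge_of_tendsto' hroot fun n => Real.one_le_rpow (hone n) (by positivity)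
  have hlog : Tendsto (fun n : ℕ => Real.log ‖M ^ n‖ / n) atTop (𝓝 (Real.log (rho A))) := by
    refine (hroot.log (by positivity)).congr fun n => ?_
    rw [Real.log_rpow (by linarith [hone n]), div_mul_eq_mul_div, one_mul]
  have hup := tendsto_add_log_div_add hlog 0 (Real.log d) 0
  refine tendsto_of_tendsto_of_tendsto_of_le_of_le hlog hup (fun n => ?_) (fun n => ?_)
  · have := hone n
    exact div_le_div_of_nonneg_right (Real.log_le_log (by linarith) (hle n)) (by positivity)
  · have h1 := hone n
    have h2 : (0 : ℝ) < entrySum A n := by exact_mod_cast one_le_entrySum hdiag n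
    have hd : (d : ℝ) ≠ 0 := by
      have := i₀.pos
      positivity
    simp only [add_zero, zero_mul]
    refine div_le_div_of_nonneg_right ?_ (by positivity)
    rw [add_comm, ← Real.log_mul hd (by positivity)]
    exact Real.log_le_log h2 (hge n)

/-! ### The topological degree -/

theorem deg_eq_log_rho (hA : Determines A) (hfin : HasFiniteRepresentation A)
    (hfree : ∃ i, IsRightFree A i) [Finite 𝒜] [Nontrivial 𝒜] {X : Set (G A → 𝒜)} {m : ℕ}
    (hSFT : IsSFT A (m + 1) X) (hne : X.Nonempty)
    (hX : ∀ b ∈ blocks A X m, IsEssentialBlock A X b) :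
    deg A X = ((Real.log (rho A) : ℝ) : EReal) := by
  obtain ⟨N, hN⟩ := exists_two_pow_le_ncard_blocks hA hSFT hne hX
  have hs : ∀ n, (1 : ℝ) ≤ entrySum A n := fun n => by
    obtain ⟨i, hi⟩ := hfree
    exact_mod_cast one_le_entrySum (hi i) n
  set C : ℝ := ((vertexF A).ncard : ℝ) with hCdef
  set r : ℕ → ℝ := fun n => ((rightFreeSphere hA n).ncard : ℝ) with hr
  have hball : ∀ n : ℕ, ((Δ A (n + 1)).ncard : ℝ) ≤ C * (((n : ℝ) + 2) * r (n + 1)) := fun n => by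
    have := ncard_Δ_le hA hfin hfree (n := n + 1) (by omega)
    have h' : ((Δ A (n + 1)).ncard : ℝ) ≤
      ((vertexF A).ncard * ((n + 1 + 1) * (rightFreeSphere hA (n + 1)).ncard) : ℕ) := by
      exact_mod_cast this
    refine h'.trans_eq ?_
    push_cast
    simp only [hCdef, hr]
    ring
  have hsΔ : ∀ n, (entrySum A n : ℝ) ≤ (Δ A (n + 1)).ncard := fun n => by
    exact_mod_cast entrySum_le_ncard_Δ hA n
  have hrs : ∀ n : ℕ, r (n + 1) ≤ entrySum A n := fun n =>
    Nat.cast_le.2 (ncard_rightFreeSphere_le hA n)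
  have hr0 : ∀ n, 0 ≤ r n := fun n => Nat.cast_nonneg _
  have hC0 : 0 ≤ C := Nat.cast_nonneg _
  -- From `1 ≤ entrySum A n ≤ |Δ_{n+1}|`; positivity of both `C` and `r (n + 1)` follows.
  have hprod : ∀ n : ℕ, 0 < C * (((n : ℝ) + 2) * r (n + 1)) := fun n => by
    linarith [hs n, hsΔ n, hball n]
  have hC : 0 < C := hC0.lt_of_ne fun h => by
    have := hprod 0
    rw [← h, zero_mul] at this
    exact lt_irrefl _ this
  have hrpos : ∀ n, 0 < r (n + 1) := fun n => (hr0 _).lt_of_ne fun h => by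
    have := hprod n
    rw [← h, mul_zero, mul_zero] at this
    exact lt_irrefl _ this
  have hlog2 : 0 < Real.log 2 := Real.log_pos one_lt_two
  set a : ℝ := (Nat.card 𝒜 : ℝ) with ha
  have hloga : 0 < Real.log a := Real.log_pos (Nat.one_lt_cast.2 Finite.one_lt_card)
  have hlow : ∀ n, r (n + 1) * Real.log 2 ≤
      Real.log ((blocks A X (n + (N + 1))).ncard : ℝ) := fun n => by
    have h : ((2 : ℝ) ^ (rightFreeSphere hA (n + 1)).ncard) ≤
        (blocks A X (n + 1 + N)).ncard := by exact_mod_cast hN (n + 1)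
    rw [show n + (N + 1) = n + 1 + N by ring]
    refine le_trans ?_ (Real.log_le_log (by positivity) h)
    rw [Real.log_pow]
  have hpos : ∀ n, 0 < Real.log ((blocks A X (n + (N + 1))).ncard : ℝ) := fun n =>
    (mul_pos (hrpos n) hlog2).trans_le (hlow n)
  have hupp : ∀ n, Real.log ((blocks A X (n + (N + 1))).ncard : ℝ) ≤
      C * Real.log a * (((n + N : ℕ) : ℝ) + 2) * entrySum A (n + N) := fun n => by
    have h1 : ((blocks A X (n + N + 1)).ncard : ℝ) ≤ a ^ (Δ A (n + N + 1)).ncard := by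
      rw [ha]
      exact_mod_cast ncard_blocks_le hA X (n + N + 1)
    have h0 : (0 : ℝ) < (blocks A X (n + N + 1)).ncard := by
      rcases (Nat.cast_nonneg (α := ℝ) (blocks A X (n + N + 1)).ncard).eq_or_lt with h | h
      · have := hpos n
        rw [← add_assoc, ← h, Real.log_zero] at this
        exact absurd this (lt_irrefl _)
      · exact h
    have h2 := Real.log_le_log h0 h1
    rw [Real.log_pow] at h2
    calc _ ≤ ((Δ A (n + N + 1)).ncard : ℝ) * Real.log a := h2
      _ ≤ C * ((((n + N : ℕ) : ℝ) + 2) * entrySum A (n + N)) * Real.log a := by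
        gcongr
        refine (hball (n + N)).trans ?_
        gcongr
        exact hrs _
      _ = _ := by ring
  have hrate := tendsto_log_entrySum_div hfree
  have hlim : Tendsto (fun n : ℕ =>
      Real.log (Real.log ((blocks A X n).ncard : ℝ)) / (n : ℝ)) atTop (𝓝 (Real.log (rho A))) := by
    rw [← tendsto_add_atTop_iff_nat (N + 1)]
    -- The coefficient `-1` comes from `r (n + 1) ≥ entrySum A n / (C (n + 2))`; in `hU` the
    -- coefficient `1` comes from the factor `n + 2` in the bound on the ball.
    have hL := tendsto_add_log_div_add hrate (-1) (Real.log (Real.log 2) - Real.log C) (N + 1)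
    have hU := (tendsto_add_atTop_iff_nat N).2
      (tendsto_add_log_div_add hrate 1 (Real.log (C * Real.log a)) 1)
    refine tendsto_of_tendsto_of_tendsto_of_le_of_le hL hU (fun n => ?_) (fun n => ?_)
    · refine div_le_div_of_nonneg_right ?_ (Nat.cast_nonneg _)
      have h1 := Real.log_le_log (mul_pos (hrpos n) hlog2) (hlow n)
      rw [Real.log_mul (hrpos n).ne' hlog2.ne'] at h1
      have h2 := Real.log_le_log (by linarith [hs n]) ((hsΔ n).trans (hball n))
      rw [Real.log_mul hC.ne' (mul_pos (by positivity) (hrpos n)).ne',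
        Real.log_mul (by positivity) (hrpos n).ne'] at h2
      linarith
    · have h3 : n + N + 1 = n + (N + 1) := by ring
      rw [h3]
      refine div_le_div_of_nonneg_right ?_ (Nat.cast_nonneg _)
      have h1 := Real.log_le_log (hpos n) (hupp n)
      have h2 : (0 : ℝ) < entrySum A (n + N) := by linarith [hs (n + N)]
      rw [Real.log_mul (by positivity) h2.ne', Real.log_mul (by positivity) (by positivity)] at h1
      linarith
  -- The upper limit is an actual limit.
  exact ((continuous_coe_real_ereal.tendsto _).comp hlim).limsup_eq

end MonoidShift

theorem theorem4p2 {d : ℕ} (A : Matrix (Fin d) (Fin d) ℕ)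
    (hA : MonoidShift.Determines A)
    (hfin : MonoidShift.HasFiniteRepresentation A)
    (hfree : ∃ i, MonoidShift.IsRightFree A i)
    {𝒜 : Type*} [Finite 𝒜] [Nontrivial 𝒜]
    (X : Set (MonoidShift.G A → 𝒜)) :
    (MonoidShift.IsSFT A 1 X → (∀ a : 𝒜, MonoidShift.IsEssential A X a) →
      MonoidShift.deg A X = ((Real.log (MonoidShift.rho A) : ℝ) : EReal)) ∧
    (∀ m : ℕ, MonoidShift.IsSFT A (m + 1) X → X.Nonempty →
      (∀ b ∈ MonoidShift.blocks A X m, MonoidShift.IsEssentialBlock A X b) →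
      MonoidShift.deg A X = ((Real.log (MonoidShift.rho A) : ℝ) : EReal)) := by
  refine ⟨fun hSFT hX => ?_, fun m hSFT hne hX =>
    MonoidShift.deg_eq_log_rho hA hfin hfree hSFT hne hX⟩
  refine MonoidShift.deg_eq_log_rho (m := 0) hA hfin hfree hSFT ?_
    fun b _ => MonoidShift.isEssentialBlock_of_isEssential hX b
  obtain ⟨a⟩ : Nonempty 𝒜 := inferInstance
  obtain ⟨n, hn⟩ := hX a
  obtain ⟨_, t, ht, _⟩ := Set.nonempty_of_ncard_ne_zero (by omega : (MonoidShift.blocks A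
    {t ∈ X | t 1 = a} n).ncard ≠ 0)
  exact ⟨t, ht.1⟩
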